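/- Let $\sigma(n)$ denote the sum of the positive divisors of the positive integer $n$. For integers $k \ge 1$ and $a$, a positive integer $n$ with $\sigma(n) = kn + a$ is called a *regular* solution of this equation if $n = pm$ for some prime $p$ and positive integer $m$ with $p \nmid m$, $\sigma(m)/m = k$ and $\sigma(m) = a$; all other solutions are called *sporadic*. Let $k$ be a fixed positive integer. Then the number of sporadic solutions $n \le x$ to $\sigma(n) = kn + a$ is at most $x^{3/5 + o_k(1)}$ as $x \to \infty$, uniformly in $a \in \mathbb{Z}$. That is, there is a function $\varepsilon_k$, depending only on $k$, with $\varepsilon_k(x) \to 0$ as $x \to \infty$, such that for every real $x \ge 3$ and every integer $a$, $$\#\{ n \le x : n \text{ is a sporadic solution to } \sigma(n) = kn + a \} \le x^{3/5 + \varepsilon_k(x)}.$$ -/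

import Mathlib

open Filter Topology

/-- `n` is a positive integer with `σ(n) = k n + a`. -/
def IsSigmaSolution (k : ℕ) (a : ℤ) (n : ℕ) : Prop :=
  0 < n ∧ (ArithmeticFunction.sigma 1 n : ℤ) = (k : ℤ) * (n : ℤ) + a

/-- `n = p m` with `p` prime, `p ∤ m` (so `m ≠ 0`), `σ(m) / m = k` and `σ(m) = a`. -/
def IsRegularSolution (k : ℕ) (a : ℤ) (n : ℕ) : Prop :=
  ∃ p m : ℕ, p.Prime ∧ n = p * m ∧ ¬ p ∣ m ∧
    (ArithmeticFunction.sigma 1 m : ℚ) / (m : ℚ) = (k : ℚ) ∧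
    (ArithmeticFunction.sigma 1 m : ℤ) = a

/-- A sporadic solution of `σ(n) = k n + a`: a solution that is not regular. -/
def IsSporadicSolution (k : ℕ) (a : ℤ) (n : ℕ) : Prop :=
  IsSigmaSolution k a n ∧ ¬ IsRegularSolution k a n

/-- The set of sporadic solutions `n ≤ x` of `σ(n) = k n + a`. -/
def sporadicSolutions (k : ℕ) (a : ℤ) (x : ℝ) : Set ℕ :=
  {n : ℕ | (n : ℝ) ≤ x ∧ IsSporadicSolution k a n}

/-- This set is finite, so its `Set.ncard` is a genuine count. -/
theorem sporadicSolutions_finite (k : ℕ) (a : ℤ) (x : ℝ) :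
    (sporadicSolutions k a x).Finite :=
  (Set.finite_Iic ⌊x⌋₊).subset fun _ hn => Nat.le_floor hn.1

/-! Let a ≠ 0 and u = x^(1/5). By `unitary_divisor_cases`, each n ≤ x is at most u³, or is pm or mpq
with m ≤ u³ and simple primes p, q, or has a unitary divisor m ≥ u² that is at most u³ or
squarefull. Write D = σ(m) - km.

For n = pm the equation is linear in p with coefficient D; if D = 0 then n is regular, otherwise m
determines p. For n = mpq, multiplying by D factors the equation as (Dp + σ(m))(Dq + σ(m)) =
`factorTarget`, nonzero for sporadic n, so each m leaves x^o(1) choices; D = 0 forces m ∣ a.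

For n = mm' with m unitary, reduction modulo σ(m) fixes km' modulo σ(m)/g, where g = gcd(m, σ(m))
divides a. This leaves at most 1 + kxg/m² values of m'. Summing over m ≥ u² costs x^o(1)(u³ + x/u²),
which balances at x^(3/5).

For a = 0 the condition g ∣ a is empty. There the k-perfect numbers are counted by Wirsing's method:
a smooth part A leaves few rough cofactors B, since σ(A)σ(B) = kAB forces the primes of B one after
another. -/

/-! ### Divisor bound and squarefull numbers -/

/-- The divisor function grows slower than any positive power. -/
theorem exists_card_divisors_le_rpow {δ : ℝ} (hδ : 0 < δ) :
    ∃ C : ℝ, 1 ≤ C ∧ ∀ n : ℕ, n ≠ 0 → (n.divisors.card : ℝ) ≤ C * (n : ℝ) ^ δ := by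
  set K : ℝ := 1 + 1 / (δ * Real.log 2) with hK
  have hl2 : 0 < Real.log 2 := Real.log_pos one_lt_two
  have hdl : 0 < δ * Real.log 2 := by positivity
  have hK1 : 1 ≤ K := by
    have : 0 < 1 / (δ * Real.log 2) := by positivity
    linarith
  -- For p ≥ P one has p^δ ≥ 2, so e + 1 ≤ 2^e ≤ p^(eδ) without loss. Only the fewer than P smaller
  -- primes cost a factor K.
  set P : ℕ := ⌈(2 : ℝ) ^ (1 / δ)⌉₊ with hP
  have key : ∀ p e : ℕ, p.Prime →
      ((e : ℝ) + 1) ≤ (if p < P then K else 1) * ((p : ℝ) ^ e) ^ δ := by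
    intro p e hp
    have hp2 : (2 : ℝ) ≤ p := by exact_mod_cast hp.two_le
    have hcomm : ((p : ℝ) ^ e) ^ δ = ((p : ℝ) ^ δ) ^ e := by
      rw [← Real.rpow_natCast, ← Real.rpow_natCast, ← Real.rpow_mul (by positivity),
        ← Real.rpow_mul (by positivity), mul_comm]
    split_ifs with h
    · have h1 : ((2 : ℝ) ^ e) ^ δ ≤ ((p : ℝ) ^ e) ^ δ := by gcongr
      have h2 : 1 + δ * Real.log 2 * e ≤ ((2 : ℝ) ^ e) ^ δ := by
        rw [Real.rpow_def_of_pos (by positivity), Real.log_pow]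
        have := Real.add_one_le_exp (e * Real.log 2 * δ)
        linarith
      have h3 : (e : ℝ) + 1 ≤ K * (1 + δ * Real.log 2 * e) := by
        have : K * (1 + δ * Real.log 2 * e)
            = 1 + e + 1 / (δ * Real.log 2) + δ * Real.log 2 * e := by
          rw [hK]; field_simp; ring
        rw [this]
        have h4 : 0 < 1 / (δ * Real.log 2) := by positivity
        have h5 : 0 ≤ δ * Real.log 2 * e := by positivity
        linarith
      calc (e : ℝ) + 1 ≤ K * (1 + δ * Real.log 2 * e) := h3
        _ ≤ K * ((p : ℝ) ^ e) ^ δ := by gcongr; exact h2.trans h1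
    · have h1 : (2 : ℝ) ≤ (p : ℝ) ^ δ := by
        have h2 : (2 : ℝ) ^ (1 / δ) ≤ p := (Nat.le_ceil _).trans (by exact_mod_cast not_lt.mp h)
        calc (2 : ℝ) = ((2 : ℝ) ^ (1 / δ)) ^ δ := by
              rw [← Real.rpow_mul (by norm_num)]; field_simp; simp
          _ ≤ _ := by gcongr
      rw [one_mul, hcomm]
      calc (e : ℝ) + 1 ≤ 2 ^ e := by exact_mod_cast Nat.lt_two_pow_self
        _ ≤ _ := by gcongr
  refine ⟨K ^ P, one_le_pow₀ hK1, fun n hn => ?_⟩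
  rw [Nat.card_divisors hn]
  push_cast
  calc ∏ p ∈ n.primeFactors, ((n.factorization p : ℝ) + 1)
      ≤ ∏ p ∈ n.primeFactors,
          (if p < P then K else 1) * ((p : ℝ) ^ n.factorization p) ^ δ :=
        Finset.prod_le_prod (fun _ _ => by positivity)
          fun p hp => key p _ (Nat.prime_of_mem_primeFactors hp)
    _ = (∏ p ∈ n.primeFactors, (if p < P then K else 1)) * (n : ℝ) ^ δ := by
        rw [Finset.prod_mul_distrib, Real.finsetProd_rpow _ _ (fun _ _ => by positivity)]
        congr 2
        conv_rhs => rw [← Nat.prod_factorization_pow_eq_self hn]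
        rw [Finsupp.prod, Nat.support_factorization]
        push_cast
        rfl
    _ ≤ K ^ P * (n : ℝ) ^ δ := by
        gcongr
        rw [Finset.prod_ite, Finset.prod_const, Finset.prod_const_one, mul_one]
        refine pow_le_pow_right₀ hK1 ?_
        calc _ ≤ (Finset.range P).card := Finset.card_le_card fun p hp => by
              simp at hp ⊢; exact hp.2
          _ = P := Finset.card_range P

/-- Every positive integer is the product of a squarefull and a squarefree number that are
coprime. -/
theorem exists_squarefull_mul_squarefree (n : ℕ) (hn : n ≠ 0) :
    ∃ s t : ℕ, n = s * t ∧ s.Coprime t ∧ Squarefree t ∧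
      ∀ p : ℕ, p.Prime → p ∣ s → p ^ 2 ∣ s := by
  induction n using Nat.recOnPosPrimePosCoprime with
  | zero => exact absurd rfl hn
  | one => exact ⟨1, 1, by simp, by simp, by simp, fun p hp h => by simp_all [Nat.Prime.ne_one]⟩
  | prime_pow p e hp he =>
    rcases Nat.lt_or_ge 1 e with h | h
    · refine ⟨p ^ e, 1, by simp, by simp, by simp, fun q hq hqp => ?_⟩
      rw [(Nat.prime_dvd_prime_iff_eq hq hp).1 (hq.dvd_of_dvd_pow hqp)]
      exact pow_dvd_pow _ h
    · obtain rfl : e = 1 := by omega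
      refine ⟨1, p ^ 1, by simp, by simp, by simpa using hp.squarefree, fun q hq h => ?_⟩
      simp_all [Nat.Prime.ne_one]
  | coprime a b ha hb hab iha ihb =>
    obtain ⟨s, t, rfl, hst, ht, hs⟩ := iha (by omega)
    obtain ⟨s', t', rfl, hst', ht', hs'⟩ := ihb (by omega)
    simp only [Nat.coprime_mul_iff_left, Nat.coprime_mul_iff_right] at hab
    refine ⟨s * s', t * t', by ring, ?_, ?_, ?_⟩
    · simp only [Nat.coprime_mul_iff_left, Nat.coprime_mul_iff_right]
      exact ⟨⟨hst, hab.1.2.symm⟩, hab.2.1, hst'⟩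
    · exact (Nat.squarefree_mul hab.2.2).2 ⟨ht, ht'⟩
    · intro p hp h
      rcases hp.dvd_mul.1 h with h | h
      · exact (hs p hp h).mul_right _
      · exact (hs' p hp h).mul_left _

/-- A squarefull number has the form `a² b` with `b ∣ a`. -/
theorem exists_sq_mul_dvd_of_squarefull (s : ℕ) (hs0 : s ≠ 0)
    (hs : ∀ p : ℕ, p.Prime → p ∣ s → p ^ 2 ∣ s) : ∃ a b : ℕ, s = a ^ 2 * b ∧ b ∣ a := by
  obtain ⟨b, a, hab, hb⟩ := Nat.sq_mul_squarefree s
  have ha0 : a ≠ 0 := by rintro rfl; simp at hab; omega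
  have hb0 : b ≠ 0 := by rintro rfl; simp at hab; omega
  refine ⟨a, b, hab.symm, ?_⟩
  refine (Nat.factorization_le_iff_dvd hb0 ha0).1 fun p => ?_
  by_cases hp : p.Prime
  · have h1 := hb.natFactorization_le_one p
    rcases Nat.eq_zero_or_pos (b.factorization p) with h | h
    · omega
    have hpb : p ∣ b := Nat.dvd_of_factorization_pos (by omega)
    have h2 := hs p hp (hab ▸ hpb.mul_left _)
    have h3 := (hp.pow_dvd_iff_le_factorization hs0).1 h2
    rw [← hab, Nat.factorization_mul (by positivity) hb0, Nat.factorization_pow] at h3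
    simp at h3
    omega
  · simp [Nat.factorization_eq_zero_of_not_prime _ hp]

/-! ### Case distinction on the factorization of n -/

/-- The case distinction behind the exponent `3/5`: an integer `n ≤ u⁵` is at most `u³`, or has one or
two simple prime factors with cofactor at most `u³`, or has a convenient unitary divisor. -/
theorem unitary_divisor_cases {u : ℝ} (hu : 1 < u) {n : ℕ} (hn : n ≠ 0) (hnu : (n : ℝ) ≤ u ^ 5) :
    (n : ℝ) ≤ u ^ 3 ∨
    (∃ p m : ℕ, p.Prime ∧ n = p * m ∧ ¬ p ∣ m ∧ (m : ℝ) ≤ u ^ 3) ∨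
    (∃ p q m : ℕ, p.Prime ∧ q.Prime ∧ p < q ∧ n = m * p * q ∧ ¬ p ∣ m ∧ ¬ q ∣ m ∧
      (m : ℝ) ≤ u ^ 3) ∨
    (∃ m m' : ℕ, n = m * m' ∧ m.Coprime m' ∧ u ^ 2 ≤ (m : ℝ) ∧
      ((m : ℝ) ≤ u ^ 3 ∨ ∀ p : ℕ, p.Prime → p ∣ m → p ^ 2 ∣ m)) := by
  obtain ⟨s, t, hst, hcop, ht, hs⟩ := exists_squarefull_mul_squarefree n hn
  have hu0 : 0 < u := by linarith
  have hu23 : u ^ 2 ≤ u ^ 3 := pow_le_pow_right₀ hu.le (by norm_num)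
  have hs0 : s ≠ 0 := by rintro rfl; simp at hst; omega
  have ht0 : t ≠ 0 := by rintro rfl; simp at hst; omega
  by_cases hsu : u ^ 2 ≤ (s : ℝ)
  · exact Or.inr (Or.inr (Or.inr ⟨s, t, hst, hcop, hsu, Or.inr hs⟩))
  push Not at hsu
  by_cases ht1 : t = 1
  · left
    subst ht1
    rw [hst]; push_cast; linarith
  obtain ⟨p, hp, hpmax⟩ := t.primeFactors.exists_max_image id (Nat.nonempty_primeFactors.2 (by omega))
  have hpp := Nat.prime_of_mem_primeFactors hp
  obtain ⟨t₁, rfl⟩ := Nat.dvd_of_mem_primeFactors hp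
  have hpt₁ : p.Coprime t₁ := Nat.coprime_of_squarefree_mul ht
  have ht₁0 : t₁ ≠ 0 := by rintro rfl; simp at ht0
  rw [Nat.coprime_mul_iff_right] at hcop
  have hps : ¬ p ∣ s := fun h => hpp.one_lt.ne' (Nat.eq_one_of_dvd_coprimes hcop.1 h dvd_rfl)
  by_cases h1 : ((s * t₁ : ℕ) : ℝ) ≤ u ^ 3
  · refine Or.inr (Or.inl ⟨p, s * t₁, hpp, by rw [hst]; ring, ?_, h1⟩)
    rw [hpp.dvd_mul, not_or]
    exact ⟨hps, (hpp.coprime_iff_not_dvd).1 hpt₁⟩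
  push Not at h1
  by_cases h2 : ∃ q t₂ : ℕ, q.Prime ∧ t₁ = q * t₂ ∧ ((s * t₂ : ℕ) : ℝ) ≤ u ^ 3
  · obtain ⟨q, t₂, hq, rfl, h2⟩ := h2
    have hqp : q ≤ p := hpmax q (by
      rw [Nat.mem_primeFactors]; exact ⟨hq, ⟨p * t₂, by ring⟩, ht0⟩)
    have hne : q ≠ p := by
      rintro rfl
      exact hq.one_lt.ne' (Nat.eq_one_of_dvd_coprimes hpt₁ dvd_rfl (Dvd.intro _ rfl))
    rw [Nat.coprime_mul_iff_right] at hpt₁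
    rw [Nat.coprime_mul_iff_right] at hcop
    have hqt : q.Coprime t₂ := Nat.coprime_of_squarefree_mul (ht.squarefree_of_dvd (Dvd.intro_left p rfl))
    refine Or.inr (Or.inr (Or.inl ⟨q, p, s * t₂, hq, hpp, by omega, by rw [hst]; ring, ?_, ?_, h2⟩))
    · rw [hq.dvd_mul, not_or]
      exact ⟨fun h => hq.one_lt.ne' (Nat.eq_one_of_dvd_coprimes hcop.2.1 h dvd_rfl),
        (hq.coprime_iff_not_dvd).1 hqt⟩
    · rw [hpp.dvd_mul, not_or]
      exact ⟨hps, (hpp.coprime_iff_not_dvd).1 hpt₁.2⟩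
  push Not at h2
  -- If q ≥ u, the largest prime p is also at least u, and a cofactor above u³ would give n > u⁵.
  have hsmall : ∀ q : ℕ, q.Prime → q ∣ t₁ → (q : ℝ) < u := by
    rintro q hq ⟨t₂, ht₂⟩
    have h3 := h2 q t₂ hq ht₂
    have hqp : q ≤ p := hpmax q (by
      rw [Nat.mem_primeFactors]; exact ⟨hq, ⟨p * t₂, by rw [ht₂]; ring⟩, ht0⟩)
    by_contra! h
    have h4 : u ≤ (p : ℝ) := h.trans (by exact_mod_cast hqp)
    have h5 : (n : ℝ) = ((s * t₂ : ℕ) : ℝ) * (q * p) := by rw [hst, ht₂]; push_cast; ring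
    have h6 : u * u ≤ q * p := by gcongr
    have : u ^ 3 * (u * u) < ((s * t₂ : ℕ) : ℝ) * (q * p) :=
      mul_lt_mul h3 h6 (by positivity) (by positivity)
    nlinarith
  -- Take d minimal. Removing one prime q < u from d drops s * d below u², so s * d itself is at
  -- most u³.
  have hex : ∃ d : ℕ, d ∣ t₁ ∧ u ^ 2 ≤ ((s * d : ℕ) : ℝ) := ⟨t₁, dvd_rfl, by linarith⟩
  classical
  obtain ⟨hd, hdu⟩ := Nat.find_spec hex
  have hmin := fun d => Nat.find_min (m := d) hex
  set d := Nat.find hex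
  have hd0 : d ≠ 0 := by rintro h; rw [h] at hd; exact ht₁0 (zero_dvd_iff.1 hd)
  have hd1 : d ≠ 1 := by intro h; rw [h, mul_one] at hdu; linarith
  obtain ⟨q, hq, e, he⟩ := Nat.exists_prime_and_dvd hd1
  have hqd : q ∣ t₁ := dvd_trans ⟨e, he⟩ hd
  have he0 : 0 < e := Nat.pos_of_ne_zero (by rintro rfl; simp at he; omega)
  have hed : e < d := by rw [he]; nlinarith [hq.two_le]
  have h7 : ((s * e : ℕ) : ℝ) < u ^ 2 := by
    by_contra! h
    exact hmin e hed ⟨dvd_trans ⟨q, by rw [he]; ring⟩ hd, h⟩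
  obtain ⟨f, hf⟩ := hd
  refine Or.inr (Or.inr (Or.inr ⟨s * d, f * p, by rw [hst, hf]; ring, ?_, hdu, Or.inl ?_⟩))
  · have hsq : Squarefree (d * (f * p)) := by
      have : p * t₁ = d * (f * p) := by rw [hf]; ring
      rwa [this] at ht
    refine Nat.Coprime.mul_left ?_ (Nat.coprime_of_squarefree_mul hsq)
    rw [hf, Nat.coprime_mul_iff_right] at hcop
    exact Nat.Coprime.mul_right hcop.2.2 hcop.1
  · have h8 : ((s * d : ℕ) : ℝ) = ((s * e : ℕ) : ℝ) * q := by rw [he]; push_cast; ring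
    rw [h8]
    have := hsmall q hq hqd
    calc _ ≤ u ^ 2 * u := by gcongr
      _ = u ^ 3 := by ring

/-! ### Tools for σ and for counting -/

open ArithmeticFunction in
theorem sigma_one_mul_prime {p m : ℕ} (hp : p.Prime) (hpm : ¬ p ∣ m) :
    sigma 1 (p * m) = (p + 1) * sigma 1 m := by
  rw [isMultiplicative_sigma.map_mul_of_coprime ((hp.coprime_iff_not_dvd).2 hpm)]
  congr 1
  rw [sigma_one_apply, hp.sum_divisors, add_comm]

open ArithmeticFunction in
theorem self_le_sigma_one (n : ℕ) : n ≤ sigma 1 n := by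
  rcases eq_or_ne n 0 with rfl | hn
  · simp
  rw [sigma_one_apply]
  exact Finset.single_le_sum (f := fun d => d) (fun _ _ => Nat.zero_le _) (Nat.mem_divisors_self n hn)

/-- A set has at most as many elements as there are labels, if each element has a label that
determines it. -/
theorem ncard_le_card_of_label {α β : Type*} {S : Set α} {T : Finset β} (R : α → β → Prop)
    (h : ∀ n ∈ S, ∃ l ∈ T, R n l)
    (hinj : ∀ n ∈ S, ∀ n' ∈ S, ∀ l ∈ T, R n l → R n' l → n = n') : S.ncard ≤ T.card := by
  classical
  rcases S.eq_empty_or_nonempty with rfl | ⟨n₀, hn₀⟩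
  · simp
  obtain ⟨l₀, hl₀, -⟩ := h n₀ hn₀
  have h' : ∀ n, ∃ l, n ∈ S → l ∈ T ∧ R n l := fun n => by
    by_cases hn : n ∈ S
    · obtain ⟨l, hl⟩ := h n hn
      exact ⟨l, fun _ => hl⟩
    · exact ⟨l₀, fun h => absurd h hn⟩
  choose f hf using h'
  rw [← Set.ncard_coe_finset]
  refine Set.ncard_le_ncard_of_injOn f (fun n hn => (hf n hn).1) ?_ T.finite_toSet
  intro n hn n' hn' he
  exact hinj n hn n' hn' (f n) (hf n hn).1 (hf n hn).2 (he ▸ (hf n' hn').2)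

/-- If `m` is `k`-perfect, `q ∤ m` and `m q` solves the equation, then `m q` is a regular solution. -/
theorem isRegularSolution_of_perfect {k : ℕ} {a : ℤ} {q m : ℕ} (hq : q.Prime) (hqm : ¬ q ∣ m)
    (hsol : IsSigmaSolution k a (q * m))
    (hm : (ArithmeticFunction.sigma 1 m : ℤ) = k * m) : IsRegularSolution k a (q * m) := by
  have hm0 : m ≠ 0 := by rintro rfl; simp at hqm
  refine ⟨q, m, hq, rfl, hqm, ?_, ?_⟩
  · rw [div_eq_iff (by exact_mod_cast hm0)]
    exact_mod_cast hm
  · have h := hsol.2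
    rw [sigma_one_mul_prime hq hqm] at h
    push_cast at h
    rw [hm] at h ⊢
    linarith

/-! ### One or two simple primes times a small cofactor -/

theorem ncard_sporadic_prime_mul_le (k : ℕ) (a : ℤ) (x W : ℝ) (hW : 0 ≤ W) :
    ({n ∈ sporadicSolutions k a x |
      ∃ p m : ℕ, p.Prime ∧ n = p * m ∧ ¬ p ∣ m ∧ (m : ℝ) ≤ W}.ncard : ℝ) ≤ W := by
  refine le_trans ?_ (Nat.floor_le hW)
  norm_cast
  refine le_of_le_of_eq (ncard_le_card_of_label (T := Finset.Icc 1 ⌊W⌋₊)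
    (fun n m => ∃ p : ℕ, p.Prime ∧ n = p * m ∧ ¬ p ∣ m) ?_ ?_)
    (by simp)
  · rintro n ⟨hn, p, m, hp, rfl, hpm, hm⟩
    refine ⟨m, ?_, p, hp, rfl, hpm⟩
    rw [Finset.mem_Icc]
    exact ⟨Nat.pos_of_ne_zero (by rintro rfl; simp at hpm), Nat.le_floor hm⟩
  · rintro n ⟨hn, -⟩ n' ⟨hn', -⟩ m - ⟨p, hp, rfl, hpm⟩ ⟨q, hq, rfl, hqm⟩
    have h1 := hn.2.1.2
    have h2 := hn'.2.1.2
    rw [sigma_one_mul_prime hp hpm] at h1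
    rw [sigma_one_mul_prime hq hqm] at h2
    push_cast at h1 h2
    by_cases hD : (ArithmeticFunction.sigma 1 m : ℤ) = k * m
    · exact absurd (isRegularSolution_of_perfect hp hpm hn.2.1 hD) hn.2.2
    · have : ((ArithmeticFunction.sigma 1 m : ℤ) - k * m) * ((p : ℤ) - q) = 0 := by
        linear_combination h1 - h2
      rcases mul_eq_zero.1 this with h | h
      · exact absurd (sub_eq_zero.1 h) hD
      · have : p = q := by exact_mod_cast sub_eq_zero.1 h
        rw [this]

/-- The product `(D p + σ(m)) (D q + σ(m))` with `D = σ(m) - k m`, for a solution `m p q`. -/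
def factorTarget (k : ℕ) (a : ℤ) (m : ℕ) : ℤ :=
  ((ArithmeticFunction.sigma 1 m : ℤ) - k * m) * (a - ArithmeticFunction.sigma 1 m)
    + (ArithmeticFunction.sigma 1 m : ℤ) ^ 2

theorem sigma_one_mul_two_primes {p q m : ℕ} (hp : p.Prime) (hq : q.Prime) (hpq : p < q)
    (hpm : ¬ p ∣ m) (hqm : ¬ q ∣ m) :
    ArithmeticFunction.sigma 1 (m * p * q) = ArithmeticFunction.sigma 1 m * (p + 1) * (q + 1) := by
  have h : ¬ q ∣ p * m := by
    rw [hq.dvd_mul, not_or]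
    exact ⟨fun h => hpq.ne' ((Nat.prime_dvd_prime_iff_eq hq hp).1 h), hqm⟩
  rw [show m * p * q = q * (p * m) by ring, sigma_one_mul_prime hq h, sigma_one_mul_prime hp hpm]
  ring

/-- The equation reads Dpq + σ(m)(p + q) + σ(m) = a; multiply by D and complete the product. -/
theorem mul_eq_factorTarget {k : ℕ} {a : ℤ} {p q m : ℕ} (hp : p.Prime) (hq : q.Prime)
    (hpq : p < q) (hpm : ¬ p ∣ m) (hqm : ¬ q ∣ m) (h : IsSigmaSolution k a (m * p * q)) :
    (((ArithmeticFunction.sigma 1 m : ℤ) - k * m) * p + ArithmeticFunction.sigma 1 m) *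
      (((ArithmeticFunction.sigma 1 m : ℤ) - k * m) * q + ArithmeticFunction.sigma 1 m)
      = factorTarget k a m := by
  have h1 := h.2
  rw [sigma_one_mul_two_primes hp hq hpq hpm hqm] at h1
  push_cast at h1
  rw [factorTarget]
  linear_combination ((ArithmeticFunction.sigma 1 m : ℤ) - k * m) * h1

/-- The factor Dp + σ(m) equals σ(pm) - kpm. If it vanished, pm would be k-perfect and q(pm)
regular; likewise with p and q exchanged. -/
theorem factorTarget_ne_zero {k : ℕ} {a : ℤ} {p q m : ℕ} (hp : p.Prime) (hq : q.Prime)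
    (hpq : p < q) (hpm : ¬ p ∣ m) (hqm : ¬ q ∣ m) (h : IsSporadicSolution k a (m * p * q)) :
    factorTarget k a m ≠ 0 := by
  rw [← mul_eq_factorTarget hp hq hpq hpm hqm h.1]
  have key : ∀ r r' : ℕ, r.Prime → r'.Prime → r ≠ r' → ¬ r ∣ m → ¬ r' ∣ m →
      m * p * q = r' * (r * m) →
      ((ArithmeticFunction.sigma 1 m : ℤ) - k * m) * r + ArithmeticFunction.sigma 1 m ≠ 0 := by
    intro r r' hr hr' hne hrm hrm' heq h0
    refine h.2 ?_
    have hsol := h.1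
    rw [heq] at hsol ⊢
    have hnd : ¬ r' ∣ r * m := by
      rw [hr'.dvd_mul, not_or]
      exact ⟨fun h => hne ((Nat.prime_dvd_prime_iff_eq hr' hr).1 h).symm, hrm'⟩
    refine isRegularSolution_of_perfect hr' hnd hsol ?_
    rw [sigma_one_mul_prime hr hrm]
    push_cast
    linear_combination h0
  exact mul_ne_zero (key p q hp hq hpq.ne hpm hqm (by ring))
    (key q p hq hp hpq.ne' hqm hpm (by ring))

/-- If D ≠ 0, then m and the signed divisor Dp + σ(m) of `factorTarget` determine p and then q. If D
= 0, the equation becomes σ(m)(p + q + 1) = a with σ(m) = km, so m ∣ a, and m with p ≤ √x determines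
q. -/
theorem ncard_sporadic_two_primes_le (k : ℕ) (a : ℤ) (x W N : ℝ)
    (hW : 0 ≤ W) (hN0 : 0 ≤ N)
    (ha : (a.natAbs.divisors.card : ℝ) ≤ N)
    (hN : ∀ m : ℕ, (m : ℝ) ≤ W → ((factorTarget k a m).natAbs.divisors.card : ℝ) ≤ N) :
    ({n ∈ sporadicSolutions k a x |
      ∃ p q m : ℕ, p.Prime ∧ q.Prime ∧ p < q ∧ n = m * p * q ∧ ¬ p ∣ m ∧ ¬ q ∣ m ∧
        (m : ℝ) ≤ W}.ncard : ℝ) ≤ N * (2 * W + √x + 1) := by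
  classical
  set S := {n ∈ sporadicSolutions k a x |
      ∃ p q m : ℕ, p.Prime ∧ q.Prime ∧ p < q ∧ n = m * p * q ∧ ¬ p ∣ m ∧ ¬ q ∣ m ∧
        (m : ℝ) ≤ W} with hS
  let s : ℕ → ℤ := fun m => ArithmeticFunction.sigma 1 m
  let S₁ := {n ∈ sporadicSolutions k a x |
      ∃ p q m : ℕ, p.Prime ∧ q.Prime ∧ p < q ∧ n = m * p * q ∧ ¬ p ∣ m ∧ ¬ q ∣ m ∧
        (m : ℝ) ≤ W ∧ s m - k * m ≠ 0}
  let S₂ := {n ∈ sporadicSolutions k a x |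
      ∃ p q m : ℕ, p.Prime ∧ q.Prime ∧ p < q ∧ n = m * p * q ∧ ¬ p ∣ m ∧ ¬ q ∣ m ∧
        (m : ℝ) ≤ W ∧ s m - k * m = 0}
  have hfin := sporadicSolutions_finite k a x
  have hsub : S ⊆ S₁ ∪ S₂ := by
    rintro n ⟨hn, p, q, m, hp, hq, hpq, he, hpm, hqm, hm⟩
    by_cases hD : s m - k * m = 0
    · exact Or.inr ⟨hn, p, q, m, hp, hq, hpq, he, hpm, hqm, hm, hD⟩
    · exact Or.inl ⟨hn, p, q, m, hp, hq, hpq, he, hpm, hqm, hm, hD⟩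
  have hcard : S.ncard ≤ S₁.ncard + S₂.ncard :=
    (Set.ncard_le_ncard hsub (hfin.subset fun n hn => hn.elim (·.1) (·.1))).trans
      (Set.ncard_union_le _ _)
  have h1 : (S₁.ncard : ℝ) ≤ W * (N * 2) := by
    let T : Finset (Σ _ : ℕ, ℕ × Bool) := (Finset.Icc 1 ⌊W⌋₊).sigma
      fun m => (factorTarget k a m).natAbs.divisors ×ˢ Finset.univ
    have hT : S₁.ncard ≤ T.card := by
      refine ncard_le_card_of_label (fun n l => ∃ p q : ℕ, p.Prime ∧ q.Prime ∧ p < q ∧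
        n = l.1 * p * q ∧ ¬ p ∣ l.1 ∧ ¬ q ∣ l.1 ∧ s l.1 - k * l.1 ≠ 0 ∧
        (s l.1 - k * l.1) * p + s l.1 = if l.2.2 then (l.2.1 : ℤ) else -l.2.1) ?_ ?_
      · rintro n ⟨hn, p, q, m, hp, hq, hpq, rfl, hpm, hqm, hm, hD⟩
        have e1 := mul_eq_factorTarget hp hq hpq hpm hqm hn.2.1
        have e2 := factorTarget_ne_zero hp hq hpq hpm hqm hn.2
        set z := (s m - k * m) * p + s m with hz
        have hzd : z ∣ factorTarget k a m := ⟨_, e1.symm⟩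
        refine ⟨⟨m, z.natAbs, decide (0 ≤ z)⟩, ?_, p, q, hp, hq, hpq, rfl, hpm, hqm, hD, ?_⟩
        · simp only [T, Finset.mem_sigma, Finset.mem_product, Nat.mem_divisors, Finset.mem_Icc,
            Finset.mem_univ, and_true]
          exact ⟨⟨Nat.pos_of_ne_zero (by rintro rfl; simp at hpm), Nat.le_floor hm⟩,
            Int.natAbs_dvd_natAbs.2 hzd, Int.natAbs_ne_zero.2 e2⟩
        · by_cases h0 : 0 ≤ z
          · simp only [h0, decide_true, if_true, ← hz]; omega
          · simp only [h0, decide_false, ← hz, Bool.false_eq_true, if_false]; omega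
      · rintro n ⟨hn, -⟩ n' ⟨hn', -⟩ ⟨m, d, b⟩ - ⟨p, q, hp, hq, hpq, rfl, hpm, hqm, hD, h⟩
          ⟨p', q', hp', hq', hpq', rfl, hpm', hqm', -, h'⟩
        dsimp only at *
        have e1 := mul_eq_factorTarget hp hq hpq hpm hqm hn.2.1
        have e2 := factorTarget_ne_zero hp hq hpq hpm hqm hn.2
        have e1' := mul_eq_factorTarget hp' hq' hpq' hpm' hqm' hn'.2.1
        have hpp : (s m - k * m) * p = (s m - k * m) * p' := by linarith
        have hpp' : (p : ℤ) = p' := mul_left_cancel₀ hD hpp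
        have hpe : p = p' := by exact_mod_cast hpp'
        subst hpe
        have hz0 : (s m - k * m) * p + s m ≠ 0 := by
          intro h0
          rw [← e1] at e2
          exact e2 (by simp only [s] at h0; rw [h0, zero_mul])
        have h3 := mul_left_cancel₀ hz0 (e1.trans e1'.symm)
        have hqq : (s m - k * m) * q = (s m - k * m) * q' := by simp only [s]; linarith
        have hqq' : q = q' := by exact_mod_cast mul_left_cancel₀ hD hqq
        rw [hqq']
    have hTc : (T.card : ℝ) ≤ W * (N * 2) := by
      rw [Finset.card_sigma]
      push_cast
      calc _ ≤ ∑ m ∈ Finset.Icc 1 ⌊W⌋₊, N * 2 := by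
            refine Finset.sum_le_sum fun m hm => ?_
            rw [Finset.card_product]
            push_cast
            rw [Finset.card_univ, Fintype.card_bool]
            have := hN m ((Nat.cast_le.2 (Finset.mem_Icc.1 hm).2).trans (Nat.floor_le hW))
            push_cast
            gcongr
        _ = ⌊W⌋₊ * (N * 2) := by simp
        _ ≤ _ := by gcongr; exact Nat.floor_le hW
    exact (Nat.cast_le.2 hT).trans hTc
  have h2 : (S₂.ncard : ℝ) ≤ N * (√x + 1) := by
    let T : Finset (ℕ × ℕ) := a.natAbs.divisors ×ˢ Finset.range (⌊√x⌋₊ + 1)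
    have hT : S₂.ncard ≤ T.card := by
      refine ncard_le_card_of_label (fun n l => ∃ q : ℕ, q ≠ 0 ∧ 0 < s l.1 ∧
        n = l.1 * l.2 * q ∧ s l.1 * (l.2 + q + 1) = a) ?_ ?_
      · rintro n ⟨hn, p, q, m, hp, hq, hpq, rfl, hpm, hqm, hm, hD⟩
        have hm0 : 0 < m := Nat.pos_of_ne_zero (by rintro rfl; simp at hpm)
        have e := hn.2.1.2
        rw [sigma_one_mul_two_primes hp hq hpq hpm hqm] at e
        push_cast at e
        have hs : 0 < s m := by
          have : 0 < ArithmeticFunction.sigma 1 m := ArithmeticFunction.sigma_pos 1 m hm0.ne'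
          simp only [s]; exact_mod_cast this
        have e' : s m * (p + q + 1) = a := by
          simp only [s] at hD ⊢
          linear_combination e - p * q * hD
        refine ⟨⟨m, p⟩, ?_, q, hq.ne_zero, hs, rfl, e'⟩
        simp only [T, Finset.mem_product, Nat.mem_divisors, Finset.mem_range]
        refine ⟨⟨?_, ?_⟩, Nat.lt_succ_of_le (Nat.le_floor (Real.le_sqrt_of_sq_le ?_))⟩
        · rw [← Int.natCast_dvd, ← e', sub_eq_zero.1 hD]
          exact ⟨k * (p + q + 1), by ring⟩
        · rw [Int.natAbs_ne_zero, ← e']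
          positivity
        · refine le_trans ?_ hn.1
          have : p ^ 2 ≤ m * p * q := calc
            p ^ 2 = 1 * p * p := by ring
            _ ≤ m * p * q := by gcongr; exact hm0
          exact_mod_cast this
      · rintro n - n' - ⟨m, p⟩ - ⟨q, hq, hs, rfl, h⟩ ⟨q', hq', -, rfl, h'⟩
        dsimp only at *
        have := mul_left_cancel₀ hs.ne' (h.trans h'.symm)
        have : q = q' := by omega
        rw [this]
    have hTc : (T.card : ℝ) ≤ N * (√x + 1) := by
      rw [Finset.card_product, Finset.card_range]
      push_cast
      gcongr
      exact Nat.floor_le (Real.sqrt_nonneg x)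
    exact (Nat.cast_le.2 hT).trans hTc
  have : (S.ncard : ℝ) ≤ S₁.ncard + S₂.ncard := by exact_mod_cast hcard
  linarith


/-! ### Solutions with a convenient unitary divisor -/

/-- Among the multiples `m` of `h` with `m ≥ Y`, the sum of `h / m²` is at most `2 / Y`. -/
theorem sum_div_sq_multiples_le {h : ℕ} (hh : 0 < h) {Y : ℝ} (hY : 0 < Y) (M : Finset ℕ)
    (hM : ∀ m ∈ M, h ∣ m ∧ Y ≤ m) : ∑ m ∈ M, (h : ℝ) / (m : ℝ) ^ 2 ≤ 2 / Y := by
  classical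
  rcases M.eq_empty_or_nonempty with rfl | hne
  · simp; positivity
  obtain ⟨m₀, hm₀, hmin⟩ := M.exists_min_image id hne
  obtain ⟨⟨j₀, rfl⟩, hj₀⟩ := hM m₀ hm₀
  have hj₀pos : 0 < j₀ := Nat.pos_of_ne_zero (by rintro rfl; simp at hj₀; linarith)
  obtain ⟨m₁, hm₁, hmax⟩ := M.exists_max_image id hne
  have hh' : (0 : ℝ) < h := by exact_mod_cast hh
  -- The open interval starts at j₀ - 1 because the tail of 1/j² beyond it is at most 2/j₀, and h *
  -- j₀ ≥ Y.
  have hsub : M ⊆ (Finset.Ioo (j₀ - 1) (m₁ + 1)).image (h * ·) := by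
    intro m hm
    obtain ⟨⟨j, rfl⟩, -⟩ := hM m hm
    refine Finset.mem_image.2 ⟨j, Finset.mem_Ioo.2 ⟨?_, ?_⟩, rfl⟩
    · have : j₀ ≤ j := Nat.le_of_mul_le_mul_left (hmin _ hm) hh
      omega
    · have : h * j ≤ m₁ := hmax _ hm
      have : j ≤ h * j := Nat.le_mul_of_pos_left _ hh
      omega
  calc ∑ m ∈ M, (h : ℝ) / (m : ℝ) ^ 2
      ≤ ∑ m ∈ (Finset.Ioo (j₀ - 1) (m₁ + 1)).image (h * ·), (h : ℝ) / (m : ℝ) ^ 2 :=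
        Finset.sum_le_sum_of_subset_of_nonneg hsub fun _ _ _ => by positivity
    _ = ∑ j ∈ Finset.Ioo (j₀ - 1) (m₁ + 1), (1 / (h : ℝ)) * ((j : ℝ) ^ 2)⁻¹ := by
        rw [Finset.sum_image fun i _ j _ hij => Nat.eq_of_mul_eq_mul_left hh hij]
        refine Finset.sum_congr rfl fun j hj => ?_
        have : 0 < (j : ℝ) := by
          have := (Finset.mem_Ioo.1 hj).1
          exact_mod_cast (by omega : 0 < j)
        push_cast
        field_simp
    _ = (1 / (h : ℝ)) * ∑ j ∈ Finset.Ioo (j₀ - 1) (m₁ + 1), ((j : ℝ) ^ 2)⁻¹ := by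
        rw [Finset.mul_sum]
    _ ≤ (1 / (h : ℝ)) * (2 / (((j₀ - 1 : ℕ) : ℝ) + 1)) := by
        gcongr
        exact sum_Ioo_inv_sq_le _ _
    _ = 2 / ((h * j₀ : ℕ) : ℝ) := by
        have : (((j₀ - 1 : ℕ) : ℝ) + 1) = j₀ := by exact_mod_cast (by omega : j₀ - 1 + 1 = j₀)
        rw [this]
        push_cast
        have : (0 : ℝ) < j₀ := by exact_mod_cast hj₀pos
        field_simp
    _ ≤ 2 / Y := by gcongr

/-- The number of solutions having a unitary divisor in a given finite set of integers `≥ Y`. -/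
theorem ncard_sporadic_unitary_divisor_le {k : ℕ} (hk : 0 < k) {a : ℤ} (ha0 : a ≠ 0) {x Y : ℝ} (hx : 0 ≤ x)
    (hY : 0 < Y) (M : Finset ℕ) (hM : ∀ m ∈ M, Y ≤ (m : ℝ)) :
    ({n ∈ sporadicSolutions k a x | ∃ m ∈ M, ∃ m' : ℕ, n = m * m' ∧ m.Coprime m'}.ncard : ℝ)
      ≤ M.card + k * x * (a.natAbs.divisors.card * (2 / Y)) := by
  classical
  let g : ℕ → ℕ := fun m => m.gcd (ArithmeticFunction.sigma 1 m)
  let M' := M.filter fun m => g m ∈ a.natAbs.divisors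
  -- The label is m with the quotient of k * m' by σ(m)/g(m); the remainder is forced by the
  -- equation. The range comes from km'g/σ(m) ≤ k(mm')g/m².
  let T : Finset (Σ _ : ℕ, ℕ) := M'.sigma
    fun m => Finset.range (⌊k * x * ((g m : ℝ) / (m : ℝ) ^ 2)⌋₊ + 1)
  have hMpos : ∀ m ∈ M, 0 < m := fun m hm => by
    have := hM m hm
    exact_mod_cast (by linarith : (0 : ℝ) < m)
  have hT : {n ∈ sporadicSolutions k a x | ∃ m ∈ M, ∃ m' : ℕ, n = m * m' ∧ m.Coprime m'}.ncard
      ≤ T.card := by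
    refine ncard_le_card_of_label (fun n l => ∃ m' : ℕ, n = l.1 * m' ∧ l.1.Coprime m' ∧
      l.2 = k * m' / (ArithmeticFunction.sigma 1 l.1 / g l.1)) ?_ ?_
    · rintro n ⟨hn, m, hm, m', rfl, hcop⟩
      have hm0 := hMpos m hm
      have hg0 : 0 < g m := Nat.gcd_pos_of_pos_left _ hm0
      have e := hn.2.1.2
      rw [ArithmeticFunction.isMultiplicative_sigma.map_mul_of_coprime hcop] at e
      refine ⟨⟨m, k * m' / (ArithmeticFunction.sigma 1 m / g m)⟩, ?_, m', rfl, hcop, rfl⟩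
      simp only [T, M', Finset.mem_sigma, Finset.mem_filter, Nat.mem_divisors, Finset.mem_range]
      refine ⟨⟨hm, ?_, by simpa using ha0⟩, Nat.lt_succ_of_le (Nat.le_floor ?_)⟩
      · rw [← Int.natCast_dvd]
        have h1 : (g m : ℤ) ∣ m := by exact_mod_cast Nat.gcd_dvd_left _ _
        have h2 : (g m : ℤ) ∣ (ArithmeticFunction.sigma 1 m : ℕ) := by
          exact_mod_cast Nat.gcd_dvd_right _ _
        have : a = (ArithmeticFunction.sigma 1 m : ℕ) * (ArithmeticFunction.sigma 1 m' : ℕ)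
            - m * (k * m') := by push_cast at e; linarith
        rw [this]
        exact dvd_sub (h2.mul_right _) (h1.mul_right _)
      · have hgd : g m ∣ ArithmeticFunction.sigma 1 m := Nat.gcd_dvd_right _ _
        have hmσ : (m : ℝ) ≤ (ArithmeticFunction.sigma 1 m : ℕ) := by
          exact_mod_cast self_le_sigma_one m
        have hm0' : (0 : ℝ) < m := by exact_mod_cast hm0
        have hg0' : (0 : ℝ) < g m := by exact_mod_cast hg0
        have hnx : (m : ℝ) * m' ≤ x := by exact_mod_cast hn.1
        calc ((k * m' / (ArithmeticFunction.sigma 1 m / g m) : ℕ) : ℝ)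
            ≤ ((k * m' : ℕ) : ℝ) / ((ArithmeticFunction.sigma 1 m / g m : ℕ) : ℝ) :=
              Nat.cast_div_le
          _ = k * m' * g m / (ArithmeticFunction.sigma 1 m : ℕ) := by
              rw [Nat.cast_div hgd hg0'.ne']
              push_cast
              have : (0 : ℝ) < (ArithmeticFunction.sigma 1 m : ℕ) := by linarith
              field_simp
          _ ≤ k * m' * g m / m := by gcongr
          _ = k * (m * m') * (g m / m ^ 2) := by field_simp
          _ ≤ _ := by gcongr
    · rintro n ⟨hn, -⟩ n' ⟨hn', -⟩ ⟨m, j⟩ hl ⟨m₁, rfl, hc, h⟩ ⟨m₂, rfl, hc', h'⟩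
      dsimp only at *
      have hm0 : 0 < m := hMpos m (Finset.mem_filter.1 (Finset.mem_sigma.1 hl).1).1
      have hg0 : 0 < g m := Nat.gcd_pos_of_pos_left _ hm0
      have hσ0 : 0 < ArithmeticFunction.sigma 1 m := ArithmeticFunction.sigma_pos 1 m hm0.ne'
      have hgd : g m ∣ ArithmeticFunction.sigma 1 m := Nat.gcd_dvd_right _ _
      have hgm : g m ∣ m := Nat.gcd_dvd_left _ _
      have e := hn.2.1.2
      have e' := hn'.2.1.2
      rw [ArithmeticFunction.isMultiplicative_sigma.map_mul_of_coprime hc] at e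
      rw [ArithmeticFunction.isMultiplicative_sigma.map_mul_of_coprime hc'] at e'
      obtain ⟨q, hq⟩ := hgd
      obtain ⟨r, hr⟩ := hgm
      have hqr : r.Coprime q := by
        have := Nat.coprime_div_gcd_div_gcd (m := m) (n := ArithmeticFunction.sigma 1 m) hg0
        rwa [show m.gcd (ArithmeticFunction.sigma 1 m) = g m from rfl, hq,
          Nat.mul_div_cancel_left _ hg0, Nat.div_eq_of_eq_mul_right hg0 hr] at this
      have hq0 : 0 < q := Nat.pos_of_ne_zero (by rintro rfl; simp at hq; omega)
      rw [hq, Nat.mul_div_cancel_left _ hg0] at h h'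
      -- Subtract the two equations and divide by g: q divides r * k * (m₁ - m₂), and r = m/g is
      -- coprime to q = σ(m)/g.
      have hd : (q : ℤ) ∣ (k * m₁ : ℕ) - (k * m₂ : ℕ) := by
        have h1 : (q : ℤ) ∣ r * (((k * m₁ : ℕ) : ℤ) - (k * m₂ : ℕ)) := by
          refine ⟨ArithmeticFunction.sigma 1 m₁ - ArithmeticFunction.sigma 1 m₂, ?_⟩
          have hg' : (g m : ℤ) ≠ 0 := by exact_mod_cast hg0.ne'
          have hr' : (m : ℤ) = g m * r := by exact_mod_cast hr
          have hq' : ((ArithmeticFunction.sigma 1 m : ℕ) : ℤ) = g m * q := by exact_mod_cast hq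
          refine mul_left_cancel₀ hg' ?_
          push_cast at e e' ⊢
          rw [hq'] at e e'
          linear_combination e' - e - (k * m₁ - k * m₂) * hr'
        exact (Nat.isCoprime_iff_coprime.2 hqr.symm).dvd_of_dvd_mul_left h1
      have hmod : k * m₂ ≡ k * m₁ [MOD q] := (Nat.modEq_iff_dvd).2 hd
      have hkm : k * m₁ = k * m₂ := by
        rw [← Nat.div_add_mod (k * m₁) q, ← Nat.div_add_mod (k * m₂) q, ← h, ← h', hmod]
      rw [Nat.eq_of_mul_eq_mul_left hk hkm]
  have hTc : (T.card : ℝ) ≤ M.card + k * x * (a.natAbs.divisors.card * (2 / Y)) := by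
    rw [Finset.card_sigma]
    push_cast
    calc ∑ m ∈ M', ((Finset.range (⌊k * x * ((g m : ℝ) / (m : ℝ) ^ 2)⌋₊ + 1)).card : ℝ)
        ≤ ∑ m ∈ M', (1 + k * x * ((g m : ℝ) / (m : ℝ) ^ 2)) := by
          refine Finset.sum_le_sum fun m _ => ?_
          rw [Finset.card_range]
          push_cast
          have := Nat.floor_le (by positivity : 0 ≤ k * x * ((g m : ℝ) / (m : ℝ) ^ 2))
          linarith
      _ = M'.card + k * x * ∑ m ∈ M', (g m : ℝ) / (m : ℝ) ^ 2 := by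
          rw [Finset.sum_add_distrib, ← Finset.mul_sum]; simp
      _ ≤ M.card + k * x * (a.natAbs.divisors.card * (2 / Y)) := by
          have hMM : M'.card ≤ M.card := Finset.card_le_card (Finset.filter_subset _ _)
          gcongr
          -- Group by the value h of g: there are at most τ(|a|) values, and every m in a fibre is a
          -- multiple of h.
          rw [← Finset.sum_fiberwise_of_maps_to (s := M') (t := a.natAbs.divisors) (g := g)
            fun m hm => (Finset.mem_filter.1 hm).2, ← nsmul_eq_mul]
          refine Finset.sum_le_card_nsmul _ _ _ fun h hh => ?_
          calc ∑ m ∈ M' with g m = h, (g m : ℝ) / (m : ℝ) ^ 2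
              = ∑ m ∈ M' with g m = h, (h : ℝ) / (m : ℝ) ^ 2 :=
                Finset.sum_congr rfl fun m hm => by rw [(Finset.mem_filter.1 hm).2]
            _ ≤ 2 / Y := by
                refine sum_div_sq_multiples_le (Nat.pos_of_mem_divisors hh) hY _ fun m hm => ?_
                obtain ⟨h1, rfl⟩ := Finset.mem_filter.1 hm
                exact ⟨Nat.gcd_dvd_left _ _, hM m (Finset.mem_filter.1 h1).1⟩
  exact (Nat.cast_le.2 hT).trans hTc

/-- The number of squarefull integers in `[1, x]` is at most `√x` times a bound for the divisor
function. -/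
theorem card_squarefull_le {x N : ℝ} (hN0 : 0 ≤ N)
    (hN : ∀ n : ℕ, (n : ℝ) ≤ √x → (n.divisors.card : ℝ) ≤ N) (M : Finset ℕ)
    (hM : ∀ m ∈ M, m ≠ 0 ∧ (m : ℝ) ≤ x ∧ ∀ p : ℕ, p.Prime → p ∣ m → p ^ 2 ∣ m) :
    (M.card : ℝ) ≤ √x * N := by
  let T : Finset (Σ _ : ℕ, ℕ) := (Finset.Icc 1 ⌊√x⌋₊).sigma fun c => c.divisors
  have hT : (M : Set ℕ).ncard ≤ T.card := by
    refine ncard_le_card_of_label (fun n l => n = l.1 ^ 2 * l.2) ?_ ?_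
    · intro n hn
      obtain ⟨hn0, hnx, hsq⟩ := hM n hn
      obtain ⟨c, b, rfl, hbc⟩ := exists_sq_mul_dvd_of_squarefull n hn0 hsq
      have hc0 : c ≠ 0 := by rintro rfl; simp at hn0
      have hb0 : b ≠ 0 := by rintro rfl; simp at hn0
      refine ⟨⟨c, b⟩, ?_, rfl⟩
      simp only [T, Finset.mem_sigma, Finset.mem_Icc, Nat.mem_divisors]
      refine ⟨⟨by omega, Nat.le_floor (Real.le_sqrt_of_sq_le (le_trans ?_ hnx))⟩, hbc, hc0⟩
      exact_mod_cast Nat.le_mul_of_pos_right _ (Nat.pos_of_ne_zero hb0)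
    · rintro n - n' - l - rfl rfl
      rfl
  rw [Set.ncard_coe_finset] at hT
  refine (Nat.cast_le.2 hT).trans ?_
  rw [Finset.card_sigma]
  push_cast
  calc ∑ c ∈ Finset.Icc 1 ⌊√x⌋₊, (c.divisors.card : ℝ) ≤ ∑ c ∈ Finset.Icc 1 ⌊√x⌋₊, N :=
        Finset.sum_le_sum fun c hc => hN c
          ((Nat.cast_le.2 (Finset.mem_Icc.1 hc).2).trans (Nat.floor_le (Real.sqrt_nonneg x)))
    _ = ⌊√x⌋₊ * N := by simp
    _ ≤ √x * N := by gcongr; exact Nat.floor_le (Real.sqrt_nonneg x)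


/-! ### Counting k-perfect numbers (the case a = 0) -/

/-- For p > y, σ(p^e)/p^e < p/(p - 1) ≤ (y + 1)/y and p^e ≥ y + 1; both bounds multiply over coprime
factors. -/
theorem sigma_one_rough_aux {y : ℕ} (B : ℕ) (hB : B ≠ 0)
    (hr : ∀ p : ℕ, p.Prime → p ∣ B → y < p) :
    ArithmeticFunction.sigma 1 B * y ^ B.primeFactors.card
      ≤ B * (y + 1) ^ B.primeFactors.card ∧ (y + 1) ^ B.primeFactors.card ≤ B := by
  induction B using Nat.recOnPosPrimePosCoprime with
  | zero => exact absurd rfl hB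
  | one => simp
  | prime_pow p e hp he =>
    have hyp : y < p := hr p hp (dvd_pow_self p he.ne')
    rw [Nat.primeFactors_prime_pow he.ne' hp, Finset.card_singleton, pow_one, pow_one]
    refine ⟨?_, Nat.succ_le_of_lt (hyp.trans_le (Nat.le_self_pow he.ne' p))⟩
    obtain ⟨r, rfl⟩ : ∃ r, p = r + 1 := ⟨p - 1, by have := hp.pos; omega⟩
    have hyr : y ≤ r := by omega
    have hr0 : 0 < r := by have := hp.two_le; omega
    have hgeom : ArithmeticFunction.sigma 1 ((r + 1) ^ e) * r + 1 = (r + 1) ^ (e + 1) := by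
      rw [ArithmeticFunction.sigma_one_apply_prime_pow hp]
      exact geom_sum_mul_add (R := ℕ) r (e + 1)
    refine Nat.le_of_mul_le_mul_right ?_ hr0
    set s := ArithmeticFunction.sigma 1 ((r + 1) ^ e)
    have hs : s * r ≤ (r + 1) ^ e * (r + 1) := by rw [← pow_succ]; omega
    calc s * y * r = (s * r) * y := by ring
      _ ≤ ((r + 1) ^ e * (r + 1)) * y := by gcongr
      _ = (r + 1) ^ e * ((r + 1) * y) := by ring
      _ ≤ (r + 1) ^ e * ((y + 1) * r) := Nat.mul_le_mul_left _ (by nlinarith)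
      _ = _ := by ring
  | coprime a b ha hb hab iha ihb =>
    obtain ⟨h1, h2⟩ := iha (by omega) fun p hp h => hr p hp (h.mul_right _)
    obtain ⟨h3, h4⟩ := ihb (by omega) fun p hp h => hr p hp (h.mul_left _)
    rw [ArithmeticFunction.isMultiplicative_sigma.map_mul_of_coprime hab,
      hab.primeFactors_mul, Finset.card_union_of_disjoint hab.disjoint_primeFactors, pow_add,
      pow_add]
    refine ⟨?_, Nat.mul_le_mul h2 h4⟩
    calc _ = (ArithmeticFunction.sigma 1 a * y ^ a.primeFactors.card) *
          (ArithmeticFunction.sigma 1 b * y ^ b.primeFactors.card) := by ring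
      _ ≤ (a * (y + 1) ^ a.primeFactors.card) * (b * (y + 1) ^ b.primeFactors.card) :=
          Nat.mul_le_mul h1 h3
      _ = _ := by ring

/-- A number with few prime factors, all large, is not abundant. -/
theorem sigma_one_lt_two_mul_of_rough {y T B : ℕ} (hy : 0 < y) (hT : 2 * T ≤ y) (hB : B ≠ 0)
    (hBT : B ≤ y ^ T) (hr : ∀ p : ℕ, p.Prime → p ∣ B → y < p) :
    ArithmeticFunction.sigma 1 B < 2 * B := by
  obtain ⟨h1, h2⟩ := sigma_one_rough_aux B hB hr
  set w := B.primeFactors.card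
  have hwT : w ≤ T := by
    by_contra! h
    have : y ^ T < (y + 1) ^ w := calc
      y ^ T < (y + 1) ^ (T + 1) := by
        calc y ^ T ≤ (y + 1) ^ T := by gcongr; omega
          _ < (y + 1) ^ (T + 1) := Nat.pow_lt_pow_right (by omega) (by omega)
      _ ≤ (y + 1) ^ w := Nat.pow_le_pow_right (by omega) h
    omega
  -- (1 + 1/y)^w ≤ e^(w/y) ≤ e^(1/2) < 2, using 2w ≤ 2T ≤ y.
  have h3 : (y + 1) ^ w < 2 * y ^ w := by
    have hy' : (0 : ℝ) < y := by exact_mod_cast hy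
    have h4 : ((y : ℝ) + 1) ^ w < 2 * (y : ℝ) ^ w := by
      have e1 : ((y : ℝ) + 1) = y * (1 + 1 / y) := by field_simp
      rw [e1, mul_pow, mul_comm]
      gcongr
      calc (1 + 1 / (y : ℝ)) ^ w ≤ (Real.exp (1 / y)) ^ w := by
            gcongr
            have := Real.add_one_le_exp (1 / (y : ℝ))
            linarith
        _ = Real.exp (w / y) := by rw [← Real.exp_nat_mul]; congr 1; ring
        _ ≤ Real.exp (1 / 2) := by
            refine Real.exp_le_exp.2 ?_
            rw [div_le_div_iff₀ hy' (by norm_num)]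
            have : 2 * w ≤ y := by omega
            have : (2 : ℝ) * w ≤ y := by exact_mod_cast this
            linarith
        _ < 2 := by
            have h := Real.exp_one_lt_d9
            have h' : Real.exp (1 / 2) ^ 2 = Real.exp 1 := by
              rw [← Real.exp_nat_mul]; norm_num
            nlinarith [Real.exp_pos (1 / 2)]
    exact_mod_cast h4
  have hyw : 0 < y ^ w := by positivity
  refine Nat.lt_of_mul_lt_mul_right (a := y ^ w) ?_
  calc _ ≤ B * (y + 1) ^ w := h1
    _ < B * (2 * y ^ w) := Nat.mul_lt_mul_of_pos_left h3 (Nat.pos_of_ne_zero hB)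
    _ = _ := by ring

theorem eq_one_of_sigma_one_eq_self {B : ℕ} (hB : B ≠ 0)
    (h : ArithmeticFunction.sigma 1 B = B) : B = 1 := by
  by_contra hB1
  rw [ArithmeticFunction.sigma_one_apply, Nat.sum_divisors_eq_sum_properDivisors_add_self] at h
  have h1 : 1 ∈ B.properDivisors := Nat.mem_properDivisors.2 ⟨one_dvd _, by omega⟩
  have := Finset.single_le_sum (f := fun d : ℕ => d) (fun _ _ => Nat.zero_le _) h1
  omega

/-- The rough cofactors `B ≤ y ^ t` completing `A` to a `k`-perfect number. -/
def roughCofactors (k y A t : ℕ) : Set ℕ :=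
  {B | B ≠ 0 ∧ A.Coprime B ∧ B ≤ y ^ t ∧ (∀ p : ℕ, p.Prime → p ∣ B → y < p) ∧
    ArithmeticFunction.sigma 1 (A * B) = k * (A * B)}

theorem roughCofactors_finite (k y A t : ℕ) : (roughCofactors k y A t).Finite :=
  (Set.finite_Iic (y ^ t)).subset fun _ h => h.2.2.1

/-- If σ(A) ∣ kA, then σ(B) is a multiple of B below 2B, so B = 1. Otherwise some prime p, depending
only on A and k, divides σ(A) to a higher power than kA, hence divides B. Only its exponent i + 1 is
free; moving p^(i+1) into A lowers t by i + 1, and the powers 2^(t-1-i) sum to less than 2^t. -/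
theorem ncard_roughCofactors_le {k y T : ℕ} (hk : 0 < k) (hy : 0 < y) (hT : 2 * T ≤ y) (t : ℕ)
    (ht : t ≤ T) (A : ℕ) (hA : 0 < A) : (roughCofactors k y A t).ncard ≤ 2 ^ t := by
  classical
  induction t using Nat.strong_induction_on generalizing A with
  | _ t ih =>
  have hσA : 0 < ArithmeticFunction.sigma 1 A := ArithmeticFunction.sigma_pos 1 A hA.ne'
  by_cases hdiv : ArithmeticFunction.sigma 1 A ∣ k * A
  · refine le_trans (b := 1) ?_ Nat.one_le_two_pow
    refine (Set.ncard_le_ncard (t := {1}) ?_ (Set.finite_singleton 1)).trans_eq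
      (Set.ncard_singleton 1)
    rintro B ⟨hB, hcop, hBt, hr, he⟩
    rw [ArithmeticFunction.isMultiplicative_sigma.map_mul_of_coprime hcop] at he
    obtain ⟨c, hc⟩ := hdiv
    have h1 : ArithmeticFunction.sigma 1 B = c * B := by
      refine Nat.eq_of_mul_eq_mul_left hσA ?_
      rw [he, ← mul_assoc, hc]; ring
    have h2 := sigma_one_lt_two_mul_of_rough hy hT hB
      (hBt.trans (Nat.pow_le_pow_right hy ht)) hr
    have h3 := self_le_sigma_one B
    have hBpos := Nat.pos_of_ne_zero hB
    have hc2 : c < 2 := by rw [h1] at h2; exact Nat.lt_of_mul_lt_mul_right h2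
    have hc0 : c ≠ 0 := by rintro rfl; omega
    obtain rfl : c = 1 := by omega
    exact eq_one_of_sigma_one_eq_self hB (by omega)
  · have hkA : k * A ≠ 0 := by positivity
    rw [← Nat.factorization_le_iff_dvd hσA.ne' hkA, Finsupp.le_def] at hdiv
    push Not at hdiv
    obtain ⟨p, hp⟩ := hdiv
    have hpp : p.Prime := by
      by_contra h
      simp [Nat.factorization_eq_zero_of_not_prime _ h] at hp
    have hsub : roughCofactors k y A t ⊆ ⋃ i ∈ Finset.range t,
        (p ^ (i + 1) * ·) '' roughCofactors k y (A * p ^ (i + 1)) (t - (i + 1)) := by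
      rintro B ⟨hB, hcop, hBt, hr, he⟩
      have he' := he
      rw [ArithmeticFunction.isMultiplicative_sigma.map_mul_of_coprime hcop] at he'
      have hσB : 0 < ArithmeticFunction.sigma 1 B := ArithmeticFunction.sigma_pos 1 B hB
      have hf := congrArg (fun z => z.factorization p) he'
      rw [← mul_assoc, Nat.factorization_mul hσA.ne' hσB.ne', Nat.factorization_mul hkA hB] at hf
      simp only [Finsupp.add_apply] at hf
      have hpos : 0 < B.factorization p := by omega
      have hpB : p ∣ B := Nat.dvd_of_factorization_pos hpos.ne'
      have hyp := hr p hpp hpB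
      obtain ⟨e, c, hpc, rfl⟩ := Nat.exists_eq_pow_mul_and_not_dvd hB p hpp.ne_one
      have he0 : e ≠ 0 := by
        rintro rfl
        rw [pow_zero, one_mul] at hpB
        exact hpc hpB
      have hc0 : c ≠ 0 := by rintro rfl; simp at hpc
      have het : e ≤ t := by
        by_contra! h
        have h1 : y ^ t < p ^ e := calc
          y ^ t ≤ p ^ t := Nat.pow_le_pow_left hyp.le t
          _ < p ^ e := Nat.pow_lt_pow_right hpp.one_lt h
        have h2 : p ^ e ≤ p ^ e * c := Nat.le_mul_of_pos_right _ (Nat.pos_of_ne_zero hc0)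
        omega
      obtain ⟨i, rfl⟩ : ∃ i, e = i + 1 := ⟨e - 1, by omega⟩
      simp only [Set.mem_iUnion, Finset.mem_range]
      rw [Nat.coprime_mul_iff_right] at hcop
      refine ⟨i, by omega, c, ⟨hc0, ?_, ?_, fun q hq h => hr q hq (h.mul_left _), ?_⟩, rfl⟩
      · exact Nat.Coprime.mul_left hcop.2 (((hpp.coprime_iff_not_dvd).2 hpc).pow_left _)
      · refine Nat.le_of_mul_le_mul_right (c := y ^ (i + 1)) ?_ (by positivity)
        rw [← pow_add, Nat.sub_add_cancel het]
        calc c * y ^ (i + 1) ≤ c * p ^ (i + 1) := by gcongr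
          _ = p ^ (i + 1) * c := mul_comm _ _
          _ ≤ y ^ t := hBt
      · rwa [mul_assoc]
    calc (roughCofactors k y A t).ncard
        ≤ (⋃ i ∈ Finset.range t, (p ^ (i + 1) * ·) ''
            roughCofactors k y (A * p ^ (i + 1)) (t - (i + 1))).ncard :=
          Set.ncard_le_ncard hsub ((Finset.range t).finite_toSet.biUnion fun i _ =>
            (roughCofactors_finite _ _ _ _).image _)
      _ ≤ ∑ i ∈ Finset.range t, ((p ^ (i + 1) * ·) ''
            roughCofactors k y (A * p ^ (i + 1)) (t - (i + 1))).ncard :=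
          Finset.set_ncard_biUnion_le _ _
      _ ≤ ∑ i ∈ Finset.range t, 2 ^ (t - 1 - i) := by
          refine Finset.sum_le_sum fun i hi => ?_
          rw [Finset.mem_range] at hi
          refine (Set.ncard_image_le (roughCofactors_finite _ _ _ _)).trans ?_
          rw [show t - 1 - i = t - (i + 1) by omega]
          exact ih _ (by omega) (by omega) _ (Nat.mul_pos hA (pow_pos hpp.pos _))
      _ = ∑ i ∈ Finset.range t, 2 ^ i := Finset.sum_range_reflect (fun i => 2 ^ i) t
      _ ≤ 2 ^ t := (Nat.geomSum_lt le_rfl (by simp)).le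

/-- Every positive integer is the product of a `y`-smooth and a `y`-rough number. -/
theorem exists_smooth_mul_rough (y n : ℕ) (hn : n ≠ 0) :
    ∃ A B : ℕ, n = A * B ∧ A.Coprime B ∧ A ∈ Nat.smoothNumbers (y + 1) ∧
      ∀ p : ℕ, p.Prime → p ∣ B → y < p := by
  simp only [Nat.mem_smoothNumbers']
  induction n using Nat.recOnPosPrimePosCoprime with
  | zero => exact absurd rfl hn
  | one => exact ⟨1, 1, by simp, by simp, fun p hp h => absurd (Nat.dvd_one.1 h) hp.ne_one,
      fun p hp h => absurd (Nat.dvd_one.1 h) hp.ne_one⟩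
  | prime_pow p e hp he =>
    rcases Nat.lt_or_ge y p with h | h
    · refine ⟨1, p ^ e, by simp, by simp,
        fun p hp h => absurd (Nat.dvd_one.1 h) hp.ne_one, fun q hq hqp => ?_⟩
      rwa [(Nat.prime_dvd_prime_iff_eq hq hp).1 (hq.dvd_of_dvd_pow hqp)]
    · refine ⟨p ^ e, 1, by simp, by simp, fun q hq hqp => ?_,
        fun p hp h => absurd (Nat.dvd_one.1 h) hp.ne_one⟩
      rw [(Nat.prime_dvd_prime_iff_eq hq hp).1 (hq.dvd_of_dvd_pow hqp)]
      omega
  | coprime a b ha hb hab iha ihb =>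
    obtain ⟨s, t, rfl, hst, hs, ht⟩ := iha (by omega)
    obtain ⟨s', t', rfl, hst', hs', ht'⟩ := ihb (by omega)
    simp only [Nat.coprime_mul_iff_left, Nat.coprime_mul_iff_right] at hab
    refine ⟨s * s', t * t', by ring, ?_, ?_, ?_⟩
    · simp only [Nat.coprime_mul_iff_left, Nat.coprime_mul_iff_right]
      exact ⟨⟨hst, hab.1.2.symm⟩, hab.2.1, hst'⟩
    · intro p hp h
      exact (hp.dvd_mul.1 h).elim (hs p hp) (hs' p hp)
    · intro p hp h
      exact (hp.dvd_mul.1 h).elim (ht p hp) (ht' p hp)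

/-- The first two factors bound the y-smooth parts A ≤ X; the last bounds the rough cofactors of
each A. -/
theorem ncard_perfect_le {k y T X : ℕ} (hk : 0 < k) (hy : 0 < y) (hT : 2 * T ≤ y)
    (hX : X ≤ y ^ T) :
    {n : ℕ | n ≠ 0 ∧ n ≤ X ∧ ArithmeticFunction.sigma 1 n = k * n}.ncard
      ≤ 2 ^ (y + 1) * X.sqrt * 2 ^ T := by
  classical
  set F := Nat.smoothNumbersUpTo X (y + 1) with hF
  have hsub : {n : ℕ | n ≠ 0 ∧ n ≤ X ∧ ArithmeticFunction.sigma 1 n = k * n} ⊆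
      ⋃ A ∈ F, (A * ·) '' roughCofactors k y A T := by
    rintro n ⟨hn, hnX, he⟩
    obtain ⟨A, B, rfl, hcop, hA, hB⟩ := exists_smooth_mul_rough y n hn
    have hA0 : 0 < A := Nat.pos_of_ne_zero (by rintro rfl; simp at hn)
    have hB0 : 0 < B := Nat.pos_of_ne_zero (by rintro rfl; simp at hn)
    simp only [Set.mem_iUnion]
    refine ⟨A, ?_, B, ⟨hB0.ne', hcop, ?_, hB, he⟩, rfl⟩
    · rw [hF, Nat.mem_smoothNumbersUpTo]
      exact ⟨(Nat.le_mul_of_pos_right _ hB0).trans hnX, hA⟩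
    · exact ((Nat.le_mul_of_pos_left _ hA0).trans hnX).trans hX
  have hFc : F.card ≤ 2 ^ (y + 1) * X.sqrt := by
    refine (Nat.smoothNumbersUpTo_card_le X (y + 1)).trans ?_
    gcongr
    · norm_num
    · calc (Nat.primesBelow (y + 1)).card ≤ (Finset.range (y + 1)).card :=
          Finset.card_le_card (Finset.filter_subset _ _)
        _ = y + 1 := Finset.card_range _
  calc _ ≤ (⋃ A ∈ F, (A * ·) '' roughCofactors k y A T).ncard :=
        Set.ncard_le_ncard hsub (F.finite_toSet.biUnion fun A _ =>
          (roughCofactors_finite _ _ _ _).image _)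
    _ ≤ ∑ A ∈ F, ((A * ·) '' roughCofactors k y A T).ncard := Finset.set_ncard_biUnion_le _ _
    _ ≤ ∑ A ∈ F, 2 ^ T := by
        refine Finset.sum_le_sum fun A hA => ?_
        refine (Set.ncard_image_le (roughCofactors_finite _ _ _ _)).trans ?_
        exact ncard_roughCofactors_le hk hy hT T le_rfl A
          (Nat.pos_of_ne_zero (Nat.ne_zero_of_mem_smoothNumbers (Nat.mem_smoothNumbersUpTo.1 hA).2))
    _ = F.card * 2 ^ T := by simp
    _ ≤ _ := by gcongr

theorem exists_ncard_perfect_le {k : ℕ} (hk : 0 < k) :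
    ∃ C : ℝ, 0 ≤ C ∧ ∀ x : ℝ, 1 ≤ x →
      ({n : ℕ | n ≠ 0 ∧ n ≤ ⌊x⌋₊ ∧ ArithmeticFunction.sigma 1 n = k * n}.ncard : ℝ)
        ≤ C * x ^ (3 / 5 : ℝ) := by
  -- With L = log₂ X, y = L/20 and T ≈ L/60: y ≥ 2^60 gives y^T > X, and 2^(y+1+T) ≤ x^(1/10) turns
  -- √x into x^(3/5). Smaller L is absorbed in the constant.
  obtain ⟨L₀, hL₀⟩ : ∃ L₀ : ℕ, ∀ L ≥ L₀, 2 ^ 60 ≤ L / 20 ∧ 2 * ((L + 1) / 60 + 1) ≤ L / 20 ∧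
      L / 20 + 1 + ((L + 1) / 60 + 1) ≤ L / 10 := ⟨20 * 2 ^ 60, fun L hL => by omega⟩
  refine ⟨2 ^ (L₀ + 1), by positivity, fun x hx => ?_⟩
  have hx0 : 0 < x := by linarith
  set X := ⌊x⌋₊ with hXdef
  have hX0 : X ≠ 0 := (Nat.floor_pos.2 hx).ne'
  have hXx : (X : ℝ) ≤ x := Nat.floor_le hx0.le
  have hx35 : 1 ≤ x ^ (3 / 5 : ℝ) := Real.one_le_rpow hx (by norm_num)
  have hC1 : (1 : ℝ) ≤ 2 ^ (L₀ + 1) := one_le_pow₀ (by norm_num)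
  set L := Nat.log 2 X with hL
  have hXL : X < 2 ^ (L + 1) := Nat.lt_pow_succ_log_self (by norm_num) X
  have hLX : 2 ^ L ≤ X := Nat.pow_log_le_self 2 hX0
  rcases Nat.lt_or_ge L L₀ with h | h
  · have h1 : {n : ℕ | n ≠ 0 ∧ n ≤ X ∧ ArithmeticFunction.sigma 1 n = k * n}.ncard ≤ X := by
      calc _ ≤ ((Finset.Icc 1 X : Finset ℕ) : Set ℕ).ncard :=
            Set.ncard_le_ncard (fun n hn => by
              simp only [Finset.coe_Icc, Set.mem_Icc]; exact ⟨Nat.pos_of_ne_zero hn.1, hn.2.1⟩)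
              (Finset.finite_toSet _)
        _ = X := by rw [Set.ncard_coe_finset]; simp
    have h2 : X ≤ 2 ^ (L₀ + 1) :=
      hXL.le.trans (Nat.pow_le_pow_right (by norm_num) (by omega))
    calc _ ≤ (2 : ℝ) ^ (L₀ + 1) := by exact_mod_cast h1.trans h2
      _ ≤ _ := le_mul_of_one_le_right (by positivity) hx35
  · obtain ⟨hy60, hTy, hsum⟩ := hL₀ L h
    set y := L / 20
    set T := (L + 1) / 60 + 1 with hT
    have hXT : X ≤ y ^ T := calc
      X ≤ 2 ^ (60 * T) := hXL.le.trans (Nat.pow_le_pow_right (by norm_num) (by omega))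
      _ = (2 ^ 60) ^ T := pow_mul _ _ _
      _ ≤ y ^ T := Nat.pow_le_pow_left hy60 T
    have hb := ncard_perfect_le hk (by omega : 0 < y) hTy hXT
    have hpow : (2 : ℝ) ^ (y + 1) * 2 ^ T ≤ x ^ (1 / 10 : ℝ) := by
      rw [← pow_add]
      calc (2 : ℝ) ^ (y + 1 + T) ≤ 2 ^ (L / 10) := pow_le_pow_right₀ (by norm_num) hsum
        _ = ((2 : ℝ) ^ (10 * (L / 10))) ^ (1 / 10 : ℝ) := by
            rw [← Real.rpow_natCast, ← Real.rpow_natCast, ← Real.rpow_mul (by norm_num)]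
            congr 1
            push_cast
            ring
        _ ≤ x ^ (1 / 10 : ℝ) := by
            refine Real.rpow_le_rpow (by positivity) ?_ (by norm_num)
            calc (2 : ℝ) ^ (10 * (L / 10)) ≤ 2 ^ L :=
                  pow_le_pow_right₀ (by norm_num) (by omega)
              _ ≤ X := by exact_mod_cast hLX
              _ ≤ x := hXx
    have hsq : (X.sqrt : ℝ) ≤ x ^ (1 / 2 : ℝ) := by
      rw [← Real.sqrt_eq_rpow]
      exact Real.nat_sqrt_le_real_sqrt.trans (Real.sqrt_le_sqrt hXx)
    calc _ ≤ ((2 ^ (y + 1) * X.sqrt * 2 ^ T : ℕ) : ℝ) := by exact_mod_cast hb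
      _ = ((2 : ℝ) ^ (y + 1) * 2 ^ T) * X.sqrt := by push_cast; ring
      _ ≤ x ^ (1 / 10 : ℝ) * x ^ (1 / 2 : ℝ) := by gcongr
      _ = x ^ (3 / 5 : ℝ) := by rw [← Real.rpow_add hx0]; norm_num
      _ ≤ _ := le_mul_of_one_le_left (by positivity) hC1


/-! ### Assembly, uniformly in a -/

/-- This gives uniformity in a: once a solution exists, a and `factorTarget` are polynomially
bounded in x, so the divisor bound for them depends on x and k only. -/
theorem abs_le_of_isSigmaSolution {k n : ℕ} {a : ℤ} {x : ℝ} (h : IsSigmaSolution k a n)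
    (hx : 1 ≤ x) (hnx : (n : ℝ) ≤ x) : |(a : ℝ)| ≤ (k + 1) * x ^ 2 := by
  have e : (a : ℝ) = (ArithmeticFunction.sigma 1 n : ℕ) - k * n := by
    have := h.2
    have h' : (((ArithmeticFunction.sigma 1 n : ℕ) : ℤ) : ℝ) = ((k * n + a : ℤ) : ℝ) := by rw [this]
    push_cast at h'
    linarith
  have h1 : ((ArithmeticFunction.sigma 1 n : ℕ) : ℝ) ≤ (n : ℝ) ^ 2 := by
    exact_mod_cast ArithmeticFunction.sigma_le_pow_succ 1 n
  have h2 : (n : ℝ) ^ 2 ≤ x ^ 2 := by gcongr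
  have h3 : (k : ℝ) * n ≤ k * x ^ 2 := by gcongr; nlinarith
  have h4 : (0 : ℝ) ≤ (ArithmeticFunction.sigma 1 n : ℕ) := Nat.cast_nonneg _
  have h5 : (0 : ℝ) ≤ k * n := by positivity
  have h6 : (0 : ℝ) ≤ k * x ^ 2 := by positivity
  rw [abs_le, e]
  constructor <;> nlinarith

theorem natAbs_factorTarget_le {k m : ℕ} {a : ℤ} {x : ℝ} (hx : 1 ≤ x)
    (ha : |(a : ℝ)| ≤ (k + 1) * x ^ 2) (hm : (m : ℝ) ≤ x) :
    ((factorTarget k a m).natAbs : ℝ) ≤ (k + 2) ^ 2 * x ^ 4 := by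
  set s : ℝ := ((ArithmeticFunction.sigma 1 m : ℕ) : ℝ) with hs
  have h1 : s ≤ (m : ℝ) ^ 2 := by
    rw [hs]
    exact_mod_cast ArithmeticFunction.sigma_le_pow_succ 1 m
  have hs0 : 0 ≤ s := Nat.cast_nonneg _
  have h2 : s ≤ x ^ 2 := h1.trans (by gcongr)
  have h3 : (k : ℝ) * m ≤ k * x ^ 2 := by gcongr; nlinarith
  have h4 : (0 : ℝ) ≤ k * m := by positivity
  have hk0 : (0 : ℝ) ≤ k * x ^ 2 := by positivity
  have h5 : |s - k * m| ≤ (k + 1) * x ^ 2 := by rw [abs_le]; constructor <;> nlinarith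
  have h6 : |(a : ℝ) - s| ≤ (k + 2) * x ^ 2 := by
    rw [abs_le] at ha ⊢
    constructor <;> nlinarith [ha.1, ha.2]
  rw [Nat.cast_natAbs, Int.cast_abs]
  have e : ((factorTarget k a m : ℤ) : ℝ) = (s - k * m) * (a - s) + s ^ 2 := by
    rw [factorTarget]; push_cast; rfl
  rw [e]
  calc |(s - k * m) * (a - s) + s ^ 2| ≤ |(s - k * m)| * |(a - s)| + s ^ 2 := by
        refine (abs_add_le _ _).trans ?_
        rw [abs_mul, abs_of_nonneg (sq_nonneg s)]
    _ ≤ ((k + 1) * x ^ 2) * ((k + 2) * x ^ 2) + (x ^ 2) ^ 2 := by gcongr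
    _ = ((k + 1) * (k + 2) + 1) * x ^ 4 := by ring
    _ ≤ _ := by
        gcongr
        have : (0 : ℝ) ≤ k := Nat.cast_nonneg k
        nlinarith

/-- The bound for the number of sporadic solutions when `a ≠ 0`, in terms of a bound `N` for the
divisor function. -/
theorem ncard_sporadic_le_of_divisor_bound {k : ℕ} (hk : 0 < k) {a : ℤ} (ha0 : a ≠ 0) {u N : ℝ}
    (hu : 1 < u) (hN1 : 1 ≤ N) (ha : |(a : ℝ)| ≤ (k + 1) * (u ^ 5) ^ 2)
    (hN : ∀ z : ℕ, (z : ℝ) ≤ (k + 2) ^ 2 * (u ^ 5) ^ 4 → (z.divisors.card : ℝ) ≤ N) :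
    ((sporadicSolutions k a (u ^ 5)).ncard : ℝ) ≤ (2 * k + 8) * (N * u ^ 3) := by
  classical
  set x := u ^ 5 with hx
  have hu0 : 0 < u := by linarith
  have hx1 : 1 ≤ x := one_le_pow₀ hu.le
  have hu3x : u ^ 3 ≤ x := pow_le_pow_right₀ hu.le (by norm_num)
  have hu31 : 1 ≤ u ^ 3 := one_le_pow₀ hu.le
  have hsqrt : √x ≤ u ^ 3 := by
    rw [Real.sqrt_le_left (by positivity), ← pow_mul]
    exact pow_le_pow_right₀ hu.le (by norm_num)
  have hxx4 : x ≤ (k + 2) ^ 2 * x ^ 4 := by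
    have h1 : x ≤ x ^ 4 := le_self_pow₀ hx1 (by norm_num)
    have : (1 : ℝ) ≤ (k + 2) ^ 2 := one_le_pow₀ (by linarith [(Nat.cast_nonneg k : (0 : ℝ) ≤ k)])
    nlinarith
  have haN : (a.natAbs.divisors.card : ℝ) ≤ N := by
    refine hN _ ?_
    rw [Nat.cast_natAbs, Int.cast_abs]
    refine ha.trans ?_
    have : (0 : ℝ) ≤ k := Nat.cast_nonneg k
    gcongr ?_ * ?_
    · nlinarith
    · exact pow_le_pow_right₀ hx1 (by norm_num)
  let M₁ := (Finset.Icc 1 ⌊u ^ 3⌋₊).filter fun m : ℕ => u ^ 2 ≤ (m : ℝ)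
  let M₂ := (Finset.Icc 1 ⌊x⌋₊).filter fun m : ℕ => u ^ 2 ≤ (m : ℝ) ∧
    ∀ p : ℕ, p.Prime → p ∣ m → p ^ 2 ∣ m
  let S := sporadicSolutions k a x
  let S₀ := {n ∈ S | (n : ℝ) ≤ u ^ 3}
  let S₁ := {n ∈ S | ∃ p m : ℕ, p.Prime ∧ n = p * m ∧ ¬ p ∣ m ∧ (m : ℝ) ≤ u ^ 3}
  let S₂ := {n ∈ S | ∃ p q m : ℕ, p.Prime ∧ q.Prime ∧ p < q ∧ n = m * p * q ∧ ¬ p ∣ m ∧ ¬ q ∣ m ∧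
    (m : ℝ) ≤ u ^ 3}
  let S₃ := {n ∈ S | ∃ m ∈ M₁ ∪ M₂, ∃ m' : ℕ, n = m * m' ∧ m.Coprime m'}
  have hfin : S.Finite := sporadicSolutions_finite k a x
  have hsub : S ⊆ S₀ ∪ (S₁ ∪ (S₂ ∪ S₃)) := by
    intro n hn
    have hn0 : n ≠ 0 := hn.2.1.1.ne'
    rcases unitary_divisor_cases hu hn0 hn.1 with h | h | h | ⟨m, m', he, hc, hm, h⟩
    · exact Or.inl ⟨hn, h⟩
    · exact Or.inr (Or.inl ⟨hn, h⟩)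
    · exact Or.inr (Or.inr (Or.inl ⟨hn, h⟩))
    · refine Or.inr (Or.inr (Or.inr ⟨hn, m, ?_, m', he, hc⟩))
      have hm0 : 0 < m := Nat.pos_of_ne_zero (by rintro rfl; simp at he; omega)
      have hm'0 : 0 < m' := Nat.pos_of_ne_zero (by rintro rfl; simp at he; omega)
      simp only [M₁, M₂, Finset.mem_union, Finset.mem_filter, Finset.mem_Icc]
      rcases h with h | h
      · exact Or.inl ⟨⟨hm0, Nat.le_floor h⟩, hm⟩
      · refine Or.inr ⟨⟨hm0, Nat.le_floor (le_trans ?_ hn.1)⟩, hm, h⟩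
        rw [he]
        exact_mod_cast Nat.le_mul_of_pos_right _ hm'0
  have h0 : (S₀.ncard : ℝ) ≤ u ^ 3 := by
    refine le_trans ?_ (Nat.floor_le (by positivity : 0 ≤ u ^ 3))
    have : S₀ ⊆ ((Finset.Icc 1 ⌊u ^ 3⌋₊ : Finset ℕ) : Set ℕ) := fun n hn => by
      simp only [Finset.coe_Icc, Set.mem_Icc]
      exact ⟨hn.1.2.1.1, Nat.le_floor hn.2⟩
    have := Set.ncard_le_ncard this (Finset.finite_toSet _)
    rw [Set.ncard_coe_finset] at this
    simpa using this
  have h1 : (S₁.ncard : ℝ) ≤ u ^ 3 := ncard_sporadic_prime_mul_le k a x _ (by positivity)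
  have h2 : (S₂.ncard : ℝ) ≤ N * (2 * u ^ 3 + √x + 1) :=
    ncard_sporadic_two_primes_le k a x _ N (by positivity) (by linarith) haN
      fun m hm => hN _ (natAbs_factorTarget_le hx1 ha (hm.trans hu3x))
  have h3 : (S₃.ncard : ℝ) ≤ (M₁ ∪ M₂).card +
      k * x * (a.natAbs.divisors.card * (2 / u ^ 2)) := by
    refine ncard_sporadic_unitary_divisor_le hk ha0 (by linarith) (by positivity) _ fun m hm => ?_
    rcases Finset.mem_union.1 hm with hm | hm
    · exact (Finset.mem_filter.1 hm).2
    · exact (Finset.mem_filter.1 hm).2.1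
  have hM₁ : (M₁.card : ℝ) ≤ u ^ 3 := by
    refine le_trans ?_ (Nat.floor_le (by positivity : 0 ≤ u ^ 3))
    have := Finset.card_filter_le (Finset.Icc 1 ⌊u ^ 3⌋₊) fun m : ℕ => u ^ 2 ≤ (m : ℝ)
    simpa using this
  have hM₂ : (M₂.card : ℝ) ≤ √x * N := by
    refine card_squarefull_le (by linarith) (fun n hn => hN n ?_) _ fun m hm => ?_
    · exact (hn.trans hsqrt).trans (hu3x.trans hxx4)
    · obtain ⟨hm1, -, hm2⟩ := Finset.mem_filter.1 hm
      rw [Finset.mem_Icc] at hm1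
      exact ⟨by omega, (Nat.le_floor_iff (by linarith)).1 hm1.2, hm2⟩
  have hM : ((M₁ ∪ M₂).card : ℝ) ≤ u ^ 3 + √x * N := by
    have : ((M₁ ∪ M₂).card : ℝ) ≤ M₁.card + M₂.card := by
      exact_mod_cast Finset.card_union_le _ _
    linarith
  have h3' : k * x * (a.natAbs.divisors.card * (2 / u ^ 2)) ≤ 2 * k * (N * u ^ 3) := by
    calc k * x * (a.natAbs.divisors.card * (2 / u ^ 2)) ≤ k * x * (N * (2 / u ^ 2)) := by gcongr
      _ = 2 * k * (N * u ^ 3) := by rw [hx]; field_simp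
  have hS : (S.ncard : ℝ) ≤ S₀.ncard + (S₁.ncard + (S₂.ncard + S₃.ncard)) := by
    have hle : S.ncard ≤ (S₀ ∪ (S₁ ∪ (S₂ ∪ S₃))).ncard :=
      Set.ncard_le_ncard hsub (hfin.subset fun n hn => by
        rcases hn with h | h | h | h <;> exact h.1)
    have e1 := Set.ncard_union_le S₀ (S₁ ∪ (S₂ ∪ S₃))
    have e2 := Set.ncard_union_le S₁ (S₂ ∪ S₃)
    have e3 := Set.ncard_union_le S₂ S₃
    exact_mod_cast (by omega : S.ncard ≤ S₀.ncard + (S₁.ncard + (S₂.ncard + S₃.ncard)))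
  have hNu : u ^ 3 ≤ N * u ^ 3 := le_mul_of_one_le_left (by positivity) hN1
  have hNs : N * √x ≤ N * u ^ 3 := by gcongr
  have hN' : N ≤ N * u ^ 3 := le_mul_of_one_le_right (by linarith) hu31
  change (S.ncard : ℝ) ≤ _
  linarith

/-- For every `δ > 0` there are `O(x ^ (3/5 + δ))` sporadic solutions up to `x`, uniformly
in `a`. -/
theorem exists_ncard_sporadic_le {k : ℕ} (hk : 0 < k) {δ : ℝ} (hδ : 0 < δ) :
    ∃ C : ℝ, 1 ≤ C ∧ ∀ x : ℝ, 3 ≤ x → ∀ a : ℤ,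
      ((sporadicSolutions k a x).ncard : ℝ) ≤ C * x ^ ((3 / 5 : ℝ) + δ) := by
  obtain ⟨C₀, hC₀, hperf⟩ := exists_ncard_perfect_le hk
  -- The divisor bound is applied to integers up to (k + 2)²x⁴, so the exponent δ/4 yields x^δ.
  obtain ⟨C₁, hC₁, hdiv⟩ := exists_card_divisors_le_rpow (by positivity : 0 < δ / 4)
  set K : ℝ := C₁ * ((k + 2 : ℝ) ^ 2) ^ (δ / 4) with hK
  have hk0 : (0 : ℝ) ≤ k := Nat.cast_nonneg k
  have hK1 : 1 ≤ K := one_le_mul_of_one_le_of_one_le hC₁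
    (Real.one_le_rpow (one_le_pow₀ (by linarith)) (by positivity))
  have hC₂ : (1 : ℝ) ≤ (2 * k + 8) * K :=
    one_le_mul_of_one_le_of_one_le (by linarith) hK1
  refine ⟨C₀ + (2 * k + 8) * K, by linarith, fun x hx a => ?_⟩
  have hx0 : 0 < x := by linarith
  have hx1 : 1 ≤ x := by linarith
  have hxδ : 1 ≤ x ^ δ := Real.one_le_rpow hx1 hδ.le
  have hpos : 0 ≤ x ^ ((3 / 5 : ℝ) + δ) := by positivity
  rw [add_mul]
  rcases eq_or_ne a 0 with rfl | ha0
  · have hle : (sporadicSolutions k 0 x).ncard ≤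
        {n : ℕ | n ≠ 0 ∧ n ≤ ⌊x⌋₊ ∧ ArithmeticFunction.sigma 1 n = k * n}.ncard := by
      refine Set.ncard_le_ncard (fun n hn => ⟨hn.2.1.1.ne', Nat.le_floor hn.1, ?_⟩)
        ((Set.finite_Iic ⌊x⌋₊).subset fun n hn => hn.2.1)
      have := hn.2.1.2
      rw [add_zero] at this
      exact_mod_cast this
    have h1 : ((sporadicSolutions k 0 x).ncard : ℝ) ≤ C₀ * x ^ (3 / 5 : ℝ) :=
      (Nat.cast_le.2 hle).trans (hperf x hx1)
    have h2 : C₀ * x ^ (3 / 5 : ℝ) ≤ C₀ * x ^ ((3 / 5 : ℝ) + δ) := by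
      gcongr
      linarith
    have h3 : 0 ≤ (2 * k + 8) * K * x ^ ((3 / 5 : ℝ) + δ) := by positivity
    linarith
  · have h3 : 0 ≤ C₀ * x ^ ((3 / 5 : ℝ) + δ) := by positivity
    rcases (sporadicSolutions k a x).eq_empty_or_nonempty with he | ⟨n, hn⟩
    · rw [he, Set.ncard_empty, Nat.cast_zero]
      positivity
    have ha := abs_le_of_isSigmaSolution hn.2.1 hx1 hn.1
    set u := x ^ (1 / 5 : ℝ) with hu
    have hu1 : 1 < u := Real.one_lt_rpow (by linarith) (by norm_num)
    have hu5 : u ^ 5 = x := by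
      rw [hu, ← Real.rpow_natCast, ← Real.rpow_mul hx0.le]; norm_num
    have hu3 : u ^ 3 = x ^ (3 / 5 : ℝ) := by
      rw [hu, ← Real.rpow_natCast, ← Real.rpow_mul hx0.le]; norm_num
    have hmain := ncard_sporadic_le_of_divisor_bound hk ha0 (N := K * x ^ δ) hu1
      (one_le_mul_of_one_le_of_one_le hK1 hxδ) (by rwa [hu5]) (fun z hz => by
        rw [hu5] at hz
        rcases eq_or_ne z 0 with rfl | hz0
        · simp only [Nat.divisors_zero, Finset.card_empty, Nat.cast_zero]; positivity
        refine (hdiv z hz0).trans ?_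
        have e : x ^ δ = (x ^ 4) ^ (δ / 4) := by
          rw [← Real.rpow_natCast, ← Real.rpow_mul hx0.le]; congr 1; push_cast; ring
        rw [hK, e, mul_assoc, ← Real.mul_rpow (by positivity) (by positivity)]
        gcongr)
    rw [hu5, hu3] at hmain
    have e : (2 * k + 8) * (K * x ^ δ * x ^ (3 / 5 : ℝ))
        = (2 * k + 8) * K * x ^ ((3 / 5 : ℝ) + δ) := by
      rw [Real.rpow_add hx0]; ring
    linarith

theorem theorem4p3 (k : ℕ) (hk : 0 < k) :
    ∃ ε : ℝ → ℝ, Tendsto ε atTop (𝓝 0) ∧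
      ∀ x : ℝ, 3 ≤ x → ∀ a : ℤ,
        ((sporadicSolutions k a x).ncard : ℝ) ≤ x ^ ((3 / 5 : ℝ) + ε x) := by
  -- ε(x) is the supremum over a of the excess exponent, finite by the uniform bound with δ = 1.
  -- Truncation at 0 makes ε ≥ 0, so only an upper bound is needed for the limit; it also handles an
  -- empty count, where `Real.log 0 = 0`.
  let f : ℝ → ℤ → ℝ := fun x a =>
    max 0 (Real.log (sporadicSolutions k a x).ncard / Real.log x - 3 / 5)
  have hf : ∀ δ : ℝ, 0 < δ → ∃ C : ℝ, 1 ≤ C ∧ ∀ x : ℝ, 3 ≤ x → ∀ a : ℤ,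
      f x a ≤ δ + Real.log C / Real.log x := by
    intro δ hδ
    obtain ⟨C, hC, h⟩ := exists_ncard_sporadic_le hk hδ
    refine ⟨C, hC, fun x hx a => ?_⟩
    have hx0 : 0 < x := by linarith
    have hlx : 0 < Real.log x := Real.log_pos (by linarith)
    have hnn : 0 ≤ δ + Real.log C / Real.log x := by
      have := Real.log_nonneg hC
      positivity
    refine max_le hnn ?_
    rcases Nat.eq_zero_or_pos (sporadicSolutions k a x).ncard with h0 | h0
    · rw [h0, Nat.cast_zero, Real.log_zero, zero_div]
      linarith
    have h0' : (0 : ℝ) < (sporadicSolutions k a x).ncard := by exact_mod_cast h0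
    have h1 := Real.log_le_log h0' (h x hx a)
    rw [Real.log_mul (by linarith) (by positivity), Real.log_rpow hx0] at h1
    rw [sub_le_iff_le_add, div_le_iff₀ hlx]
    have : (δ + Real.log C / Real.log x + 3 / 5) * Real.log x
        = Real.log C + (3 / 5 + δ) * Real.log x := by field_simp; ring
    linarith
  have hbdd : ∀ x : ℝ, 3 ≤ x → BddAbove (Set.range (f x)) := by
    intro x hx
    obtain ⟨C, -, h⟩ := hf 1 one_pos
    exact ⟨_, by rintro _ ⟨a, rfl⟩; exact h x hx a⟩
  refine ⟨fun x => ⨆ a, f x a, ?_, fun x hx a => ?_⟩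
  · rw [Metric.tendsto_atTop]
    intro η hη
    obtain ⟨C, hC, h⟩ := hf (η / 2) (by positivity)
    have hlim : Tendsto (fun x => Real.log C / Real.log x) atTop (𝓝 0) :=
      Tendsto.div_atTop tendsto_const_nhds Real.tendsto_log_atTop
    obtain ⟨x₀, hx₀⟩ := eventually_atTop.1 (hlim.eventually_lt_const (half_pos hη))
    refine ⟨max 3 x₀, fun x hx => ?_⟩
    have h1 : ⨆ a, f x a ≤ η / 2 + Real.log C / Real.log x :=
      ciSup_le fun a => h x (le_of_max_le_left hx) a
    have h2 : 0 ≤ ⨆ a, f x a := Real.iSup_nonneg fun a => le_max_left _ _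
    have h3 := hx₀ x (le_of_max_le_right hx)
    rw [Real.dist_eq, sub_zero, abs_of_nonneg h2]
    linarith
  · have hx0 : 0 < x := by linarith
    have hlx : 0 < Real.log x := Real.log_pos (by linarith)
    rcases Nat.eq_zero_or_pos (sporadicSolutions k a x).ncard with h0 | h0
    · rw [h0, Nat.cast_zero]
      positivity
    have h0' : (0 : ℝ) < (sporadicSolutions k a x).ncard := by exact_mod_cast h0
    have h1 : Real.log (sporadicSolutions k a x).ncard / Real.log x - 3 / 5 ≤ ⨆ a, f x a :=
      (le_max_right _ _).trans (le_ciSup (hbdd x hx) a)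
    rw [sub_le_iff_le_add, div_le_iff₀ hlx] at h1
    rw [← Real.log_le_log_iff h0' (by positivity), Real.log_rpow hx0]
    linarith
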